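/- Consider $\lambda$-terms in unary de Bruijn notation (not necessarily closed): a term is a de Bruijn index $\underline{n}=S^n0$ ($n\ge 0$), an abstraction $\lambda N$, or an application $N\,M$. The size is given by $|0|=1$, $|S\,\underline{n}|=|\underline{n}|+1$, $|\lambda N|=|N|+1$, $|N\,M|=|N|+|M|+1$. The set $\mathcal K$ of neutral head normal forms is the least set of terms that contains every de Bruijn index and contains $K\,N$ whenever $K\in\mathcal K$ and $N$ is a term. Let $L_\infty(z)=\sum_n [z^n]L_\infty\, z^n$ and $K(z)=\sum_n [z^n]K\,z^n$ be the ordinary generating functions counting all terms and all neutral head normal forms, respectively, by size. (There are only finitely many terms of each size.) Then: 1. $K(z)=z+z\,L_\infty(z)$. 2. The correspondence $$0\,N_1N_2\cdots N_m \longleftrightarrow (\lambda N_1)N_2\cdots N_m\quad(m>0),\qquad (S\,\underline{n})\,N_1\cdots N_m\longleftrightarrow \underline{n}\,N_1\cdots N_m\quad(m\ge 0)$$ is a bijection between $\mathcal K\setminus\{0\}$ and the set of all terms, and each neutral head normal form in $\mathcal K\setminus\{0\}$ has size one greater than the corresponding term. 3. The function $L_\infty(z)$ has a unique dominating singularity $\rho$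 (a point of its circle of convergence at which it has no analytic continuation). It is real, it is a root of $1-3z-z^2-z^3$, and $|\rho-0.29559|<10^{-5}$. There is a constant $C$ with $|C-0.60676|<10^{-5}$ such that $$[z^{n+1}]K(z)\sim \left(\frac1\rho\right)^{n}\frac{C}{n^{3/2}}\qquad(n\to\infty).$$ 4. The density of neutral head normal forms among all terms is $\rho$, that is, $\displaystyle\lim_{n\to\infty}\frac{[z^n]K(z)}{[z^n]L_\infty(z)}=\rho$. -/

import Mathlib

open Filter Topology Asymptotics

/-- De Bruijn indices in unary notation: `S (S (… 0))`. -/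
inductive DBIndex : Type
  | zero : DBIndex
  | succ : DBIndex → DBIndex

/-- Plain (not necessarily closed) lambda terms in de Bruijn notation. -/
inductive LTerm : Type
  | idx : DBIndex → LTerm
  | abs : LTerm → LTerm
  | app : LTerm → LTerm → LTerm

/-- Size of an index: each successor and the zero have size one. -/
def DBIndex.size : DBIndex → ℕ
  | .zero => 1
  | .succ n => n.size + 1

/-- Natural size: abstractions, applications, successors and zeros all have size one. -/
def LTerm.size : LTerm → ℕ
  | .idx n => n.size
  | .abs N => N.size + 1
  | .app N M => N.size + M.size + 1

/-- Neutral head normal forms: a de Bruijn index, or a neutral head normal form applied to an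
arbitrary term. -/
inductive LTerm.IsNeutralHNF : LTerm → Prop
  | idx (n : DBIndex) : LTerm.IsNeutralHNF (.idx n)
  | app {K : LTerm} (N : LTerm) : LTerm.IsNeutralHNF K → LTerm.IsNeutralHNF (.app K N)

/-- `P.apps [N₁, …, Nₘ]` is the iterated application `P N₁ … Nₘ`, associated to the left. -/
def LTerm.apps (P : LTerm) (Ns : List LTerm) : LTerm :=
  Ns.foldl LTerm.app P

/-- The correspondence between neutral head normal forms (left) and plain terms (right):
`0 N₁ N₂ … Nₘ ↔ (λ N₁) N₂ … Nₘ` for `m > 0`, and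
`(S n) N₁ … Nₘ ↔ n N₁ … Nₘ` for `m ≥ 0`. -/
inductive LTerm.Corresponds : LTerm → LTerm → Prop
  | zero (N₁ : LTerm) (Ns : List LTerm) :
      LTerm.Corresponds ((LTerm.idx .zero).apps (N₁ :: Ns)) ((LTerm.abs N₁).apps Ns)
  | succ (n : DBIndex) (Ns : List LTerm) :
      LTerm.Corresponds ((LTerm.idx n.succ).apps Ns) ((LTerm.idx n).apps Ns)

/-- The number of plain lambda terms of size `n`. -/
noncomputable def plainCount (n : ℕ) : ℕ :=
  Set.ncard {t : LTerm | t.size = n}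

/-- The number of neutral head normal forms of size `n`. -/
noncomputable def neutralHNFCount (n : ℕ) : ℕ :=
  Set.ncard {t : LTerm | t.IsNeutralHNF ∧ t.size = n}

/-- The ordinary generating function of a counting sequence, as a formal power series. -/
def genFun (a : ℕ → ℕ) : PowerSeries ℤ :=
  PowerSeries.mk fun n => (a n : ℤ)

/-- `ζ` is a dominating singularity of the generating function `∑ aₙ zⁿ`: it lies on the circle
of convergence, and the sum of the series inside the disc of convergence does not extend
analytically to a neighbourhood of `ζ`. -/
def IsDominatingSingularity (a : ℕ → ℕ) (ζ : ℂ) : Prop :=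
  ‖ζ‖ₑ = (FormalMultilinearSeries.ofScalars ℂ (fun n => (a n : ℂ))).radius ∧
    ¬ ∃ g : ℂ → ℂ, AnalyticAt ℂ g ζ ∧
      ∀ᶠ z in 𝓝 ζ, ‖z‖ < ‖ζ‖ → g z = ∑' n, (a n : ℂ) * z ^ n

/-! Structural recursion along the spine turns a term into a neutral head normal form of size one
larger: `toNeutral` lifts a head index `n` to `S n` and turns a head `λ N` into `0 N`. Its image
misses only `0`, which gives the bijection, K = z + zL and [z^(n+1)]K = [z^n]L for n > 0.

Counting terms gives L = z/(1-z) + zL + zL², and completing the square gives (1-z)(1-z-2zL)² =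
1-3z-z²-z³. With ρ the small real root, the right side is (1-z/ρ)(1+ρ(1+ρ)z+ρz²). Hence 1-z-2zL is
`regularFactor ρ`, analytic on the unit disc, times √(1-z/ρ).

The coefficients of √(1-z) are asymptotic to n^(-3/2)/Γ(-1/2), with Γ(-1/2) = -2√π. Multiplying by a
series that converges beyond the singularity only multiplies this by its value there
(`tendsto_rpow_smul_convolution`), so `tendsto_rpow_mul_plainCount` follows without contour
integrals. The constant and the density ρ are read off from it. The square root extends to every
other point of the circle, but not to ρ, a simple root. -/

theorem DBIndex.size_pos (n : DBIndex) : 0 < n.size := by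
  cases n <;> simp [DBIndex.size]

theorem DBIndex.existsUnique_size (n : ℕ) : ∃! i : DBIndex, i.size = n + 1 := by
  induction n with
  | zero =>
    refine ⟨.zero, rfl, fun i hi => ?_⟩
    cases i with
    | zero => rfl
    | succ j => have := j.size_pos; simp [DBIndex.size] at hi; omega
  | succ n ih =>
    obtain ⟨j, hj, hu⟩ := ih
    refine ⟨.succ j, by simp [DBIndex.size, hj], fun i hi => ?_⟩
    cases i with
    | zero => simp [DBIndex.size] at hi
    | succ k => rw [hu k (by simpa [DBIndex.size] using hi)]

theorem DBIndex.card_size (n : ℕ) : Nat.card {i : DBIndex // i.size = n + 1} = 1 := by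
  obtain ⟨i, hi, hu⟩ := DBIndex.existsUnique_size n
  exact Nat.card_eq_one_iff_exists.2 ⟨⟨i, hi⟩, fun j => Subtype.ext (hu j.1 j.2)⟩

/-! ### Terms, neutral head normal forms and the size decomposition -/

namespace LTerm

theorem size_pos (t : LTerm) : 0 < t.size := by
  cases t with
  | idx n => exact n.size_pos
  | abs N => simp [size]
  | app P N => simp [size]

/-- The neutral head normal form corresponding to a term. -/
def toNeutral : LTerm → LTerm
  | .idx n => .idx n.succ
  | .abs N => .app (.idx .zero) N
  | .app P N => .app P.toNeutral N

theorem toNeutral_apps (P : LTerm) (Ns : List LTerm) :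
    (P.apps Ns).toNeutral = P.toNeutral.apps Ns := by
  induction Ns generalizing P with
  | nil => rfl
  | cons N Ns ih => exact ih (P.app N)

/-- An outer application appends to the end of the argument list, so the spine form of the
correspondence can be handled by structural induction. -/
theorem Corresponds.app {k t : LTerm} (h : Corresponds k t) (N : LTerm) :
    Corresponds (k.app N) (t.app N) := by
  cases h with
  | zero N₁ Ns => simpa [apps] using Corresponds.zero N₁ (Ns ++ [N])
  | succ n Ns => simpa [apps] using Corresponds.succ n (Ns ++ [N])

theorem corresponds_toNeutral (t : LTerm) : Corresponds t.toNeutral t := by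
  induction t with
  | idx n => exact .succ n []
  | abs N => exact .zero N []
  | app P N ih => exact ih.app N

theorem corresponds_iff {k t : LTerm} : Corresponds k t ↔ t.toNeutral = k := by
  refine ⟨fun h => ?_, fun h => h ▸ corresponds_toNeutral t⟩
  cases h with
  | zero N₁ Ns => rw [toNeutral_apps]; rfl
  | succ n Ns => rw [toNeutral_apps]; rfl

theorem size_toNeutral (t : LTerm) : t.toNeutral.size = t.size + 1 := by
  induction t with
  | idx n => rfl
  | abs N => simp [toNeutral, size, DBIndex.size]; omega
  | app P N ih => simp [toNeutral, size, ih]; omega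

theorem isNeutralHNF_toNeutral (t : LTerm) : t.toNeutral.IsNeutralHNF := by
  induction t with
  | idx n => exact .idx _
  | abs N => exact .app N (.idx _)
  | app P N ih => exact .app N ih

theorem toNeutral_ne_zero (t : LTerm) : t.toNeutral ≠ .idx .zero := by
  cases t <;> simp [toNeutral]

/-- Abstractions and applications both become applications; they stay apart because the function
part is `0` in the first case and never `0` in the second. -/
theorem toNeutral_injective : Function.Injective toNeutral := by
  intro s
  induction s with
  | idx n => intro t h; cases t <;> simp_all [toNeutral]
  | abs N =>
    intro t h
    cases t with
    | idx n => simp [toNeutral] at h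
    | abs N => simp_all [toNeutral]
    | app P N =>
      simp only [toNeutral, app.injEq] at h
      exact absurd h.1.symm P.toNeutral_ne_zero
  | app P N ih =>
    intro t h
    cases t with
    | idx n => simp [toNeutral] at h
    | abs N =>
      simp only [toNeutral, app.injEq] at h
      exact absurd h.1 P.toNeutral_ne_zero
    | app Q M =>
      simp only [toNeutral, app.injEq] at h
      rw [ih h.1, h.2]

theorem exists_toNeutral_eq {k : LTerm} (hk : k.IsNeutralHNF) :
    k = .idx .zero ∨ ∃ t : LTerm, t.toNeutral = k := by
  induction hk with
  | idx n =>
    cases n with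
    | zero => exact .inl rfl
    | succ n => exact .inr ⟨.idx n, rfl⟩
  | app N _ ih =>
    rcases ih with rfl | ⟨t, rfl⟩
    · exact .inr ⟨.abs N, rfl⟩
    · exact .inr ⟨.app t N, rfl⟩

/-- Terms correspond bijectively to neutral head normal forms other than `0`. -/
noncomputable def neutralEquiv : LTerm ≃ {k : LTerm // k.IsNeutralHNF ∧ k ≠ .idx .zero} :=
  Equiv.ofBijective (fun t => ⟨t.toNeutral, t.isNeutralHNF_toNeutral, t.toNeutral_ne_zero⟩)
    ⟨fun _ _ h => toNeutral_injective (congrArg Subtype.val h), fun ⟨_, hk, h0⟩ =>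
      ((exists_toNeutral_eq hk).resolve_left h0).imp fun _ ht => Subtype.ext ht⟩

theorem coe_neutralEquiv (t : LTerm) : (neutralEquiv t : LTerm) = t.toNeutral := rfl

/-- A term of positive size is an index, an abstraction or an application. -/
def sizeEquiv (n : ℕ) : {t : LTerm // t.size = n + 1} ≃
    {i : DBIndex // i.size = n + 1} ⊕ {t : LTerm // t.size = n} ⊕
      Σ p : Finset.HasAntidiagonal.antidiagonal n, {t : LTerm // t.size = p.1.1} × {t : LTerm // t.size = p.1.2} where
  toFun
    | ⟨.idx i, h⟩ => .inl ⟨i, h⟩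
    | ⟨.abs N, h⟩ => .inr (.inl ⟨N, Nat.succ.inj h⟩)
    | ⟨.app P N, h⟩ => .inr (.inr ⟨⟨(P.size, N.size), Finset.HasAntidiagonal.mem_antidiagonal.2 (Nat.succ.inj h)⟩,
        ⟨P, rfl⟩, ⟨N, rfl⟩⟩)
  invFun
    | .inl i => ⟨.idx i.1, i.2⟩
    | .inr (.inl N) => ⟨.abs N.1, congrArg (· + 1) N.2⟩
    | .inr (.inr ⟨p, P, N⟩) => ⟨.app P.1 N.1, by
        rw [size, P.2, N.2, Finset.HasAntidiagonal.mem_antidiagonal.1 p.2]⟩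
  left_inv
    | ⟨.idx i, h⟩ => rfl
    | ⟨.abs N, h⟩ => rfl
    | ⟨.app P N, h⟩ => rfl
  right_inv
    | .inl i => rfl
    | .inr (.inl N) => rfl
    | .inr (.inr ⟨⟨⟨a, b⟩, hp⟩, ⟨P, hP⟩, ⟨N, hN⟩⟩) => by
        cases hP; cases hN; rfl

theorem finite_size_eq (n : ℕ) : Finite {t : LTerm // t.size = n} := by
  induction n using Nat.strong_induction_on with
  | _ n ih =>
    cases n with
    | zero =>
      have : IsEmpty {t : LTerm // t.size = 0} := ⟨fun t => t.1.size_pos.ne' t.2⟩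
      infer_instance
    | succ n =>
      have h1 := Nat.finite_of_card_ne_zero (DBIndex.card_size n ▸ one_ne_zero)
      have h2 := ih n (Nat.lt_succ_self n)
      have h3 (p : Finset.HasAntidiagonal.antidiagonal n) :
          Finite ({t : LTerm // t.size = p.1.1} × {t : LTerm // t.size = p.1.2}) := by
        have hp := Finset.HasAntidiagonal.mem_antidiagonal.1 p.2
        have := ih p.1.1 (by omega)
        have := ih p.1.2 (by omega)
        infer_instance
      exact Finite.of_equiv _ (sizeEquiv n).symm

end LTerm

/-! ### Recurrences for the counts -/

theorem plainCount_eq_card (n : ℕ) : plainCount n = Nat.card {t : LTerm // t.size = n} := rfl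

theorem plainCount_zero : plainCount 0 = 0 := by
  have : IsEmpty {t : LTerm // t.size = 0} := ⟨fun t => t.1.size_pos.ne' t.2⟩
  rw [plainCount_eq_card, Nat.card_of_isEmpty]

theorem plainCount_succ (n : ℕ) : plainCount (n + 1) = 1 + plainCount n +
    ∑ p ∈ Finset.HasAntidiagonal.antidiagonal n, plainCount p.1 * plainCount p.2 := by
  have h1 := DBIndex.card_size n
  have := Nat.finite_of_card_ne_zero (h1 ▸ one_ne_zero)
  have := LTerm.finite_size_eq
  simp only [plainCount_eq_card]
  rw [Nat.card_congr (LTerm.sizeEquiv n), Nat.card_sum, Nat.card_sum, Nat.card_sigma, h1, add_assoc]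
  simp only [Nat.card_prod]
  rw [Finset.sum_coe_sort (Finset.HasAntidiagonal.antidiagonal n) fun p =>
    Nat.card {t : LTerm // t.size = p.1} * Nat.card {t : LTerm // t.size = p.2}]

theorem neutralHNFCount_zero : neutralHNFCount 0 = 0 := by
  have : {t : LTerm | t.IsNeutralHNF ∧ t.size = 0} = ∅ :=
    Set.eq_empty_of_forall_notMem fun t ht => t.size_pos.ne' ht.2
  rw [neutralHNFCount, this, Set.ncard_empty]

theorem neutralHNFCount_one : neutralHNFCount 1 = 1 := by
  have : {t : LTerm | t.IsNeutralHNF ∧ t.size = 1} = {.idx .zero} := by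
    ext k
    refine ⟨fun ⟨hk, hs⟩ => ?_, fun h => h ▸ ⟨.idx _, rfl⟩⟩
    rcases LTerm.exists_toNeutral_eq hk with rfl | ⟨t, rfl⟩
    · rfl
    · rw [LTerm.size_toNeutral] at hs
      have := t.size_pos
      omega
  rw [neutralHNFCount, this, Set.ncard_singleton]

/-- Fails for n = 0: the form `0` has size one and comes from no term. -/
theorem neutralHNFCount_succ {n : ℕ} (hn : n ≠ 0) : neutralHNFCount (n + 1) = plainCount n := by
  have : {t : LTerm | t.IsNeutralHNF ∧ t.size = n + 1} =
      LTerm.toNeutral '' {t : LTerm | t.size = n} := by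
    ext k
    constructor
    · rintro ⟨hk, hs⟩
      rcases LTerm.exists_toNeutral_eq hk with rfl | ⟨t, rfl⟩
      · exact absurd (Nat.succ.inj hs).symm hn
      · exact ⟨t, by simpa [LTerm.size_toNeutral] using hs, rfl⟩
    · rintro ⟨t, ht, rfl⟩
      exact ⟨t.isNeutralHNF_toNeutral, by rw [LTerm.size_toNeutral, ht]⟩
  rw [neutralHNFCount, this, Set.ncard_image_of_injective _ LTerm.toNeutral_injective, plainCount]

theorem genFun_neutralHNFCount :
    genFun neutralHNFCount = PowerSeries.X + PowerSeries.X * genFun plainCount := by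
  ext n
  rcases n with _ | _ | n
  · simp [genFun, neutralHNFCount_zero]
  · simp [genFun, neutralHNFCount_one, PowerSeries.coeff_succ_X_mul, plainCount_zero]
  · simp [genFun, neutralHNFCount_succ, PowerSeries.coeff_succ_X_mul, PowerSeries.coeff_X]

/-! ### Formal series and their sums on a disc -/

namespace PowerSeries

/-- The power series `A` converges absolutely to `f` on the disc of radius `r` around zero. -/
def SumsTo (A : PowerSeries ℂ) (r : ℝ) (f : ℂ → ℂ) : Prop :=
  ∀ z : ℂ, ‖z‖ < r → Summable (fun n => ‖coeff n A * z ^ n‖) ∧ ∑' n, coeff n A * z ^ n = f z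

variable {A B : PowerSeries ℂ} {r : ℝ} {f g : ℂ → ℂ}

theorem SumsTo.mono (hA : A.SumsTo r f) {s : ℝ} (hs : s ≤ r) : A.SumsTo s f :=
  fun z hz => hA z (hz.trans_le hs)

theorem SumsTo.congr (hA : A.SumsTo r f) (h : ∀ z, ‖z‖ < r → f z = g z) : A.SumsTo r g :=
  fun z hz => ⟨(hA z hz).1, (hA z hz).2.trans (h z hz)⟩

theorem SumsTo.sub (hA : A.SumsTo r f) (hB : B.SumsTo r g) :
    (A - B).SumsTo r fun z => f z - g z := by
  intro z hz
  obtain ⟨a1, a2⟩ := hA z hz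
  obtain ⟨b1, b2⟩ := hB z hz
  simp only [map_sub, sub_mul]
  refine ⟨(a1.add b1).of_nonneg_of_le (fun _ => norm_nonneg _) fun n => norm_sub_le _ _, ?_⟩
  rw [a1.of_norm.tsum_sub b1.of_norm, a2, b2]

theorem SumsTo.mul (hA : A.SumsTo r f) (hB : B.SumsTo r g) :
    (A * B).SumsTo r fun z => f z * g z := by
  intro z hz
  obtain ⟨a1, a2⟩ := hA z hz
  obtain ⟨b1, b2⟩ := hB z hz
  have key (n : ℕ) : coeff n (A * B) * z ^ n = ∑ p ∈ Finset.HasAntidiagonal.antidiagonal n,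
      (coeff p.1 A * z ^ p.1) * (coeff p.2 B * z ^ p.2) := by
    rw [coeff_mul, Finset.sum_mul]
    refine Finset.sum_congr rfl fun p hp => ?_
    rw [← Finset.HasAntidiagonal.mem_antidiagonal.1 hp]
    ring
  have h1 := summable_norm_sum_mul_antidiagonal_of_summable_norm a1 b1
  have h2 := tsum_mul_tsum_eq_tsum_sum_antidiagonal_of_summable_norm a1 b1
  rw [a2, b2] at h2
  refine ⟨h1.congr fun n => by rw [key], ?_⟩
  exact (tsum_congr key).trans h2.symm

theorem sumsTo_polynomial (p : Polynomial ℂ) (r : ℝ) :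
    (p : PowerSeries ℂ).SumsTo r fun z => p.eval z := by
  intro z _
  have h : ∀ n ∉ Finset.range (p.natDegree + 1), coeff n (p : PowerSeries ℂ) * z ^ n = 0 := by
    intro n hn
    rw [Polynomial.coeff_coe, Polynomial.coeff_eq_zero_of_natDegree_lt (by simpa using hn),
      zero_mul]
  refine ⟨summable_of_ne_finset_zero (s := Finset.range (p.natDegree + 1))
    fun n hn => by rw [h n hn, norm_zero], ?_⟩
  rw [tsum_eq_sum h]
  simp [Polynomial.eval_eq_sum_range]

theorem SumsTo.rescale (hA : A.SumsTo r f) {c : ℂ} (hc : c ≠ 0) :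
    (rescale c A).SumsTo (r / ‖c‖) fun z => f (c * z) := by
  intro z hz
  have h := hA (c * z) (by
    rw [norm_mul]
    rwa [lt_div_iff₀' (norm_pos_iff.2 hc)] at hz)
  simpa [coeff_rescale, mul_pow, mul_left_comm, mul_assoc] using h

theorem sumsTo_of_hasFPowerSeriesOnBall {p : FormalMultilinearSeries ℂ ℂ ℂ}
    (h : HasFPowerSeriesOnBall f p 0 (ENNReal.ofReal r)) : (mk p.coeff).SumsTo r f := by
  intro z hz
  have hz' : z ∈ Metric.eball (0 : ℂ) (ENNReal.ofReal r) := by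
    rw [Metric.eball_ofReal]
    simpa using hz
  have e (n : ℕ) : coeff n (mk p.coeff) * z ^ n = p n fun _ => z := by
    rw [p.apply_eq_pow_smul_coeff, coeff_mk, smul_eq_mul, mul_comm]
  simp only [e]
  refine ⟨p.summable_norm_apply (Metric.eball_subset_eball h.r_le hz'), ?_⟩
  simpa using (h.hasSum hz').tsum_eq

/-- Gives access to uniqueness of power series expansions, through which identities of functions
become identities of formal series. -/
theorem SumsTo.hasFPowerSeriesOnBall (hA : A.SumsTo r f) (hr : 0 < r) :
    HasFPowerSeriesOnBall f (.ofScalars ℂ fun n => coeff n A) 0 (ENNReal.ofReal r) where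
  r_le := by
    refine ENNReal.le_of_forall_nnreal_lt fun s hs => ?_
    refine FormalMultilinearSeries.le_radius_of_summable_norm _ ?_
    have hs' : (s : ℝ) < r := by
      rwa [← ENNReal.ofReal_coe_nnreal, ENNReal.ofReal_lt_ofReal_iff hr] at hs
    simpa [FormalMultilinearSeries.ofScalars_norm] using (hA (s : ℝ) (by simpa using hs')).1
  r_pos := by simpa using hr
  hasSum := by
    intro z hz
    rw [Metric.eball_ofReal] at hz
    obtain ⟨h1, h2⟩ := hA z (by simpa using hz)
    have := h1.of_norm.hasSum
    rw [h2] at this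
    simpa [FormalMultilinearSeries.ofScalars_apply_eq, mul_comm] using this

theorem SumsTo.unique (hr : 0 < r) (hA : A.SumsTo r f) (hB : B.SumsTo r f) : A = B := by
  have := (hA.hasFPowerSeriesOnBall hr).hasFPowerSeriesAt.eq_formalMultilinearSeries
    (hB.hasFPowerSeriesOnBall hr).hasFPowerSeriesAt
  rw [FormalMultilinearSeries.ofScalars_series_eq_iff] at this
  ext n
  exact congrFun this n

theorem SumsTo.coeff_zero (hr : 0 < r) (hA : A.SumsTo r f) : coeff 0 A = f 0 := by
  rw [← (hA 0 (by simpa using hr)).2, tsum_eq_single 0 fun n hn => by simp [hn]]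
  simp

end PowerSeries

/-! ### Coefficient asymptotics of the square root -/

/-- The binomial is s(s+1)⋯(s+n-1)/n!, nearly the reciprocal of Euler's product n^s
n!/(s(s+1)⋯(s+n)) for Γ. -/
theorem Ring.choose_add_sub_one_mul_GammaSeq (s : ℂ) (hs : ∀ m : ℕ, s ≠ -m) (n : ℕ) :
    Ring.choose (s + n - 1) n * Complex.GammaSeq s n * (s + n) = (n : ℂ) ^ s := by
  have h1 : (n.factorial : ℂ) * Ring.choose (s + n - 1) n = ∏ j ∈ Finset.range n, (s + j) := by
    rw [← Ring.multichoose_eq, ← nsmul_eq_mul, Ring.factorial_nsmul_multichoose_eq_ascPochhammer,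
      Polynomial.ascPochhammer_smeval_eq_eval]
    induction n with
    | zero => simp
    | succ n ih => rw [ascPochhammer_succ_eval, ih, Finset.prod_range_succ]
  have h2 : ∏ j ∈ Finset.range n, (s + j) ≠ 0 :=
    Finset.prod_ne_zero_iff.2 fun j _ h => hs j (eq_neg_of_add_eq_zero_left h)
  have h3 : s + n ≠ 0 := fun h => hs n (eq_neg_of_add_eq_zero_left h)
  rw [Complex.GammaSeq, Finset.prod_range_succ, ← h1]
  rw [← h1] at h2
  field_simp [left_ne_zero_of_mul h2, right_ne_zero_of_mul h2]

theorem tendsto_cpow_mul_choose (s : ℂ) (hs : ∀ m : ℕ, s ≠ -m) :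
    Tendsto (fun n : ℕ => (n : ℂ) ^ (1 - s) * Ring.choose (s + n - 1) n) atTop
      (𝓝 (Complex.Gamma s)⁻¹) := by
  have hG := Complex.Gamma_ne_zero hs
  have h1 := (Complex.GammaSeq_tendsto_Gamma s).inv₀ hG
  have h2 : Tendsto (fun n : ℕ => (n : ℂ) / (s + n)) atTop (𝓝 1) := by
    have : Tendsto (fun n : ℕ => (s / n + 1)⁻¹) atTop (𝓝 ((0 + 1 : ℂ))⁻¹) :=
      ((tendsto_const_div_atTop_nhds_zero_nat s).add_const 1).inv₀ (by simp)
    rw [zero_add, inv_one] at this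
    refine this.congr' ?_
    filter_upwards [eventually_ne_atTop 0] with n hn
    have hn : (n : ℂ) ≠ 0 := Nat.cast_ne_zero.2 hn
    rw [div_add_one hn, inv_div]
  have h3 := h2.mul h1
  rw [one_mul] at h3
  refine h3.congr' ?_
  filter_upwards [eventually_ne_atTop 0, (Complex.GammaSeq_tendsto_Gamma s).eventually_ne hG]
    with n hn hGn
  have hn : (n : ℂ) ≠ 0 := Nat.cast_ne_zero.2 hn
  have h4 : s + n ≠ 0 := fun h => hs n (eq_neg_of_add_eq_zero_left h)
  have h5 := Ring.choose_add_sub_one_mul_GammaSeq s hs n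
  have h6 : (n : ℂ) ^ (1 - s) * (n : ℂ) ^ s = n := by
    rw [← Complex.cpow_add _ _ hn, sub_add_cancel, Complex.cpow_one]
  rw [← h5] at h6
  field_simp
  linear_combination -h6

theorem Complex.Gamma_neg_one_half : Complex.Gamma (-2⁻¹) = -2 * (Real.sqrt Real.pi : ℝ) := by
  have h := Complex.Gamma_add_one (-2⁻¹) (by norm_num)
  rw [show (-2⁻¹ + 1 : ℂ) = ((1 / 2 : ℝ) : ℂ) by norm_num, Complex.Gamma_ofReal,
    Real.Gamma_one_half_eq] at h
  linear_combination 2 * h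

/-- The coefficients of the square root of `1 - z`. -/
noncomputable def sqrtSeries : PowerSeries ℂ :=
  PowerSeries.mk fun n => Ring.choose (-2⁻¹ + n - 1 : ℂ) n

theorem sqrtSeries_sumsTo : sqrtSeries.SumsTo 1 fun z => (1 - z) ^ (2⁻¹ : ℂ) := by
  have h := Complex.one_div_one_sub_cpow_hasFPowerSeriesOnBall_zero (-2⁻¹)
  rw [← ENNReal.ofReal_one] at h
  convert (PowerSeries.sumsTo_of_hasFPowerSeriesOnBall h).congr
    (g := fun z => (1 - z) ^ (2⁻¹ : ℂ)) fun z _ => ?_ using 1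
  · ext n
    simp [sqrtSeries]
  · simp [Complex.cpow_neg]

theorem tendsto_rpow_smul_coeff_sqrtSeries :
    Tendsto (fun n : ℕ => (n : ℝ) ^ (3 / 2 : ℝ) • PowerSeries.coeff n sqrtSeries) atTop
      (𝓝 (-2 * ((Real.sqrt Real.pi : ℝ) : ℂ))⁻¹) := by
  rw [← Complex.Gamma_neg_one_half]
  refine (tendsto_cpow_mul_choose _ fun m h => ?_).congr fun n => ?_
  · have h2 : (1 : ℂ) = ((2 * m : ℕ) : ℂ) := by push_cast; linear_combination -2 * h
    norm_cast at h2
    omega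
  · rw [sqrtSeries, Complex.real_smul, PowerSeries.coeff_mk, Complex.ofReal_cpow (Nat.cast_nonneg n)]
    norm_num

/-! ### Asymptotics under convolution -/

theorem tendsto_rpow_smul_shift_iff {E : Type*} [NormedAddCommGroup E] [NormedSpace ℝ E] {s : ℝ}
    {a : ℕ → E} {A : E} (k : ℕ) :
    Tendsto (fun n : ℕ => ((n + k : ℕ) : ℝ) ^ s • a n) atTop (𝓝 A) ↔
      Tendsto (fun n : ℕ => (n : ℝ) ^ s • a n) atTop (𝓝 A) := by
  have h1 : Tendsto (fun n : ℕ => (1 + (k : ℝ) / n) ^ s) atTop (𝓝 ((1 + 0 : ℝ) ^ s)) :=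
    ((tendsto_const_div_atTop_nhds_zero_nat (k : ℝ)).const_add 1).rpow_const (by norm_num)
  rw [add_zero, Real.one_rpow] at h1
  have h2 : ∀ᶠ n : ℕ in atTop,
      ((n + k : ℕ) : ℝ) ^ s • a n = (1 + (k : ℝ) / n) ^ s • (n : ℝ) ^ s • a n := by
    filter_upwards [eventually_gt_atTop 0] with n hn
    have hn' : (0 : ℝ) < n := Nat.cast_pos.2 hn
    rw [smul_smul, ← Real.mul_rpow (by positivity) hn'.le, add_mul, div_mul_cancel₀ _ hn'.ne',
      one_mul, Nat.cast_add]
  constructor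
  · intro h
    have h3 := (h1.inv₀ one_ne_zero).smul h
    rw [inv_one, one_smul] at h3
    refine h3.congr' ?_
    filter_upwards [h2] with n hn
    rw [hn, inv_smul_smul₀ (by positivity)]
  · intro h
    have h3 := h1.smul h
    rw [one_smul] at h3
    exact h3.congr' (h2.mono fun n hn => hn.symm)

/-- Convolution with a rapidly decaying sequence preserves polynomial asymptotics. -/
theorem tendsto_rpow_smul_convolution {s : ℝ} (hs : 0 ≤ s) {a h : ℕ → ℂ} {A : ℂ}
    (ha : Tendsto (fun n : ℕ => (n : ℝ) ^ s • a n) atTop (𝓝 A))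
    (hh : Summable fun n : ℕ => ‖h n‖ * ((n + 1 : ℕ) : ℝ) ^ s) :
    Tendsto (fun n : ℕ => (n : ℝ) ^ s •
      ∑ p ∈ Finset.HasAntidiagonal.antidiagonal n, h p.1 * a p.2) atTop (𝓝 ((∑' n, h n) * A)) := by
  obtain ⟨M, hM⟩ := ((tendsto_rpow_smul_shift_iff 1).2 ha).norm.bddAbove_range
  have hM' (n : ℕ) : ((n + 1 : ℕ) : ℝ) ^ s * ‖a n‖ ≤ M := by
    have := hM ⟨n, rfl⟩
    simp only [norm_smul] at this
    rwa [Real.norm_of_nonneg (by positivity)] at this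
  let F : ℕ → ℕ → ℂ := fun n k => if k ≤ n then (n : ℝ) ^ s • (h k * a (n - k)) else 0
  have hF (n : ℕ) : (n : ℝ) ^ s •
      ∑ p ∈ Finset.HasAntidiagonal.antidiagonal n, h p.1 * a p.2 = ∑' k, F n k := by
    rw [Finset.Nat.sum_antidiagonal_eq_sum_range_succ fun i j => h i * a j, Finset.smul_sum,
      tsum_eq_sum (s := Finset.range n.succ)]
    · refine Finset.sum_congr rfl fun k hk => ?_
      rw [Finset.mem_range, Nat.lt_succ_iff] at hk
      simp [F, hk]
    · intro k hk
      rw [Finset.mem_range, Nat.lt_succ_iff] at hk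
      simp [F, hk]
  simp only [hF]
  rw [← tsum_mul_right]
  -- Tannery's theorem: each fixed k contributes h k * A in the limit, and the terms are dominated
  -- by ‖h k‖ (k+1)^s M.
  refine tendsto_tsum_of_dominated_convergence (hh.mul_right M) (fun k => ?_) ?_
  · rw [← tendsto_add_atTop_iff_nat k]
    refine (((tendsto_rpow_smul_shift_iff k).2 ha).const_mul (h k)).congr fun n => ?_
    simp only [F, Nat.le_add_left, if_true, Nat.add_sub_cancel]
    exact (mul_smul_comm _ _ _)
  · refine Eventually.of_forall fun n k => ?_
    have h0 : 0 ≤ M := le_trans (by positivity) (hM' 0)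
    by_cases hk : k ≤ n
    · simp only [F, hk, if_true, norm_smul, norm_mul]
      rw [Real.norm_of_nonneg (by positivity)]
      have h1 : (n : ℝ) ≤ ((k + 1 : ℕ) : ℝ) * ((n - k + 1 : ℕ) : ℝ) := by
        obtain ⟨m, rfl⟩ := Nat.exists_eq_add_of_le hk
        rw [Nat.add_sub_cancel_left]
        norm_cast
        nlinarith [Nat.zero_le (k * m)]
      calc (n : ℝ) ^ s * (‖h k‖ * ‖a (n - k)‖)
          ≤ (((k + 1 : ℕ) : ℝ) * ((n - k + 1 : ℕ) : ℝ)) ^ s * (‖h k‖ * ‖a (n - k)‖) := by gcongr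
        _ = ‖h k‖ * ((k + 1 : ℕ) : ℝ) ^ s * (((n - k + 1 : ℕ) : ℝ) ^ s * ‖a (n - k)‖) := by
          rw [Real.mul_rpow (by positivity) (by positivity)]; ring
        _ ≤ _ := by gcongr; exact hM' _
    · simp only [F, hk, if_false, norm_zero]
      exact mul_nonneg (by positivity) h0

theorem PowerSeries.SumsTo.summable_mul_rpow {A : PowerSeries ℂ} {r : ℝ} {f : ℂ → ℂ}
    (hA : A.SumsTo r f) {x : ℂ} (hx : ‖x‖ < r) (s : ℝ) :
    Summable fun n : ℕ => ‖coeff n A * x ^ n‖ * ((n + 1 : ℕ) : ℝ) ^ s := by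
  obtain ⟨m, hm⟩ := exists_nat_ge s
  obtain ⟨y, hxy, hyr⟩ := exists_between hx
  have hy : 0 < y := (norm_nonneg x).trans_lt hxy
  have h1 := (hA (y : ℝ) (by simpa [abs_of_pos hy] using hyr)).1
  -- The ratio is the mean of ‖x‖/y and 1. It is at least ‖x‖/y, below 1, and positive even for x =
  -- 0, so the geometric slack absorbs the polynomial weight.
  have h2 : Tendsto (fun n : ℕ => ((n + 1 : ℕ) : ℝ) ^ m * ((‖x‖ + y) / (2 * y)) ^ (n + 1)) atTop
      (𝓝 0) := by
    have hlt : (‖x‖ + y) / (2 * y) < 1 := by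
      rw [div_lt_one (by positivity)]
      linarith
    exact (tendsto_add_atTop_iff_nat 1).2
      (tendsto_pow_const_mul_const_pow_of_lt_one m (by positivity) hlt)
  obtain ⟨M, hM⟩ := h2.bddAbove_range
  set q := (‖x‖ + y) / (2 * y) with hq
  have hq0 : 0 < q := by positivity
  have hxq : ‖x‖ ≤ q * y := by
    rw [hq]
    field_simp
    linarith
  refine (h1.mul_right (M / q)).of_nonneg_of_le (fun n => by positivity) fun n => ?_
  have h3 : ((n + 1 : ℕ) : ℝ) ^ s ≤ ((n + 1 : ℕ) : ℝ) ^ m := by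
    rw [← Real.rpow_natCast]
    exact Real.rpow_le_rpow_of_exponent_le (by simp) hm
  have h4 : ((n + 1 : ℕ) : ℝ) ^ m * q ^ (n + 1) ≤ M := hM ⟨n, rfl⟩
  have h5 : ((n + 1 : ℕ) : ℝ) ^ m * q ^ n ≤ M / q := by
    rw [le_div_iff₀ hq0, mul_assoc, ← pow_succ]
    exact h4
  simp only [norm_mul, norm_pow, Complex.norm_real, Real.norm_of_nonneg hy.le]
  calc ‖coeff n A‖ * ‖x‖ ^ n * ((n + 1 : ℕ) : ℝ) ^ s
      ≤ ‖coeff n A‖ * (q * y) ^ n * ((n + 1 : ℕ) : ℝ) ^ m := by gcongr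
    _ = ‖coeff n A‖ * y ^ n * (((n + 1 : ℕ) : ℝ) ^ m * q ^ n) := by rw [mul_pow]; ring
    _ ≤ _ := by gcongr

/-! ### The discriminant and its analytic square root -/

/-- The square root of `(1 + ρ(1 + ρ)z + ρz²) / (1 - z)`. When `ρ` is a root of
`1 - 3z - z² - z³`, its product with the square root of `1 - z / ρ` is the square root of
`(1 - 3z - z² - z³) / (1 - z)`. -/
noncomputable def regularFactor (ρ : ℝ) (z : ℂ) : ℂ :=
  (1 + ρ * (1 + ρ) * z + ρ * z ^ 2) ^ (2⁻¹ : ℂ) / (1 - z) ^ (2⁻¹ : ℂ)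

/-- The square root of `(1 - 3z - z² - z³) / (1 - z)` for a root `ρ` of the numerator. -/
noncomputable def discriminantRoot (ρ : ℝ) (z : ℂ) : ℂ :=
  regularFactor ρ z * (1 - (ρ : ℂ)⁻¹ * z) ^ (2⁻¹ : ℂ)

theorem Complex.cpow_half_sq (x : ℂ) : (x ^ (2⁻¹ : ℂ)) ^ 2 = x := by
  simp

theorem Complex.one_add_mem_slitPlane {w : ℂ} (h : ‖w‖ < 1) : 1 + w ∈ Complex.slitPlane :=
  Complex.mem_slitPlane_of_norm_lt_one h

theorem Complex.one_sub_mem_slitPlane {w : ℂ} (h : ‖w‖ < 1) : 1 - w ∈ Complex.slitPlane := by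
  rw [sub_eq_add_neg]
  exact Complex.one_add_mem_slitPlane (by rwa [norm_neg])

/-- The terms after 1 have norm at most 0.39 + 0.3 < 1, so the branch cut is never met. -/
theorem cofactor_mem_slitPlane {ρ : ℝ} (h0 : 0 < ρ) (h1 : ρ < 0.3) {z : ℂ} (hz : ‖z‖ < 1) :
    1 + ρ * (1 + ρ) * z + ρ * z ^ 2 ∈ Complex.slitPlane := by
  rw [add_assoc]
  refine Complex.one_add_mem_slitPlane ((norm_add_le _ _).trans_lt ?_)
  have : (ρ * (1 + ρ) : ℂ) = ((ρ * (1 + ρ) : ℝ) : ℂ) := by push_cast; rfl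
  rw [this, norm_mul, norm_mul, norm_pow, Complex.norm_real, Complex.norm_real,
    Real.norm_of_nonneg (by positivity), Real.norm_of_nonneg h0.le]
  have hz0 := norm_nonneg z
  have h2 : ρ * (1 + ρ) < 0.39 := by nlinarith
  nlinarith [mul_le_mul h2.le hz.le hz0 (by norm_num), mul_le_mul h1.le
    (pow_le_one₀ hz0 hz.le : ‖z‖ ^ 2 ≤ 1) (by positivity) (by norm_num)]

theorem analyticAt_regularFactor {ρ : ℝ} (h0 : 0 < ρ) (h1 : ρ < 0.3) {z : ℂ} (hz : ‖z‖ < 1) : AnalyticAt ℂ (regularFactor ρ) z := by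
  have h2 := Complex.one_sub_mem_slitPlane hz
  have h3 := cofactor_mem_slitPlane h0 h1 hz
  refine AnalyticAt.div (AnalyticAt.cpow (by fun_prop) analyticAt_const h3)
    (AnalyticAt.cpow (by fun_prop) analyticAt_const h2) ?_
  rw [Ne, Complex.cpow_eq_zero_iff]
  exact fun h => Complex.slitPlane_ne_zero h2 h.1

theorem regularFactor_sq (ρ : ℝ) (z : ℂ) :
    regularFactor ρ z ^ 2 = (1 + ρ * (1 + ρ) * z + ρ * z ^ 2) / (1 - z) := by
  rw [regularFactor, div_pow, Complex.cpow_half_sq, Complex.cpow_half_sq]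

theorem discriminantRoot_sq {ρ : ℝ} (hρ : ρ ≠ 0) (hroot : 1 - 3 * ρ - ρ ^ 2 - ρ ^ 3 = 0) {z : ℂ}
    (hz : ‖z‖ < 1) : (1 - z) * discriminantRoot ρ z ^ 2 = 1 - 3 * z - z ^ 2 - z ^ 3 := by
  have h2 := Complex.slitPlane_ne_zero (Complex.one_sub_mem_slitPlane hz)
  have hρ' : (ρ : ℂ) ≠ 0 := Complex.ofReal_ne_zero.2 hρ
  have h3 : (1 - 3 * ρ - ρ ^ 2 - ρ ^ 3 : ℂ) = 0 := by exact_mod_cast hroot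
  rw [discriminantRoot, mul_pow, regularFactor_sq, Complex.cpow_half_sq, ← mul_assoc,
    mul_div_cancel₀ _ h2]
  field_simp
  linear_combination -z * h3

theorem discriminantRoot_zero (ρ : ℝ) : discriminantRoot ρ 0 = 1 := by
  simp [discriminantRoot, regularFactor]

/-- The radius 0.5 lies strictly between ρ and 1: inside the domain of analyticity, yet beyond the
singularity. -/
theorem exists_regularFactor_sumsTo {ρ : ℝ} (h0 : 0 < ρ) (h1 : ρ < 0.3) : ∃ A : PowerSeries ℂ, A.SumsTo 0.5 (regularFactor ρ) := by
  have hd : DifferentiableOn ℂ (regularFactor ρ)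
      (Metric.closedBall 0 ((0.5 : NNReal) : ℝ)) := by
    intro z hz
    refine (analyticAt_regularFactor h0 h1 ?_).differentiableAt.differentiableWithinAt
    rw [mem_closedBall_zero_iff] at hz
    refine hz.trans_lt ?_
    norm_num
  refine ⟨_, PowerSeries.sumsTo_of_hasFPowerSeriesOnBall
    (p := cauchyPowerSeries (regularFactor ρ) 0 ((0.5 : NNReal) : ℝ)) ?_⟩
  have h := hd.hasFPowerSeriesOnBall (by norm_num)
  rw [← ENNReal.ofReal_coe_nnreal] at h
  simpa using h

theorem discriminantRoot_sumsTo {ρ : ℝ} (h0 : 0 < ρ) (h1 : ρ < 0.3) {A : PowerSeries ℂ} (hA : A.SumsTo 0.5 (regularFactor ρ)) :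
    (A * PowerSeries.rescale (ρ : ℂ)⁻¹ sqrtSeries).SumsTo ρ (discriminantRoot ρ) := by
  have h2 := sqrtSeries_sumsTo.rescale (c := (ρ : ℂ)⁻¹)
    (inv_ne_zero (Complex.ofReal_ne_zero.2 h0.ne'))
  rw [norm_inv, Complex.norm_real, Real.norm_of_nonneg h0.le, div_inv_eq_mul, one_mul] at h2
  exact (hA.mono (by linarith)).mul h2

/-- The generating function of all terms, with complex coefficients. -/
noncomputable def plainSeries : PowerSeries ℂ :=
  PowerSeries.mk fun n => (plainCount n : ℂ)

open PowerSeries in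
theorem one_sub_X_mul_plainSeries : (1 - X) * (1 - X - 2 * X * plainSeries) ^ 2 =
    (1 - 3 * X - X ^ 2 - X ^ 3 : PowerSeries ℂ) := by
  have h1 : plainSeries =
      X * (PowerSeries.mk 1) + X * plainSeries + X * (plainSeries * plainSeries) := by
    ext n
    cases n with
    | zero => simp [plainSeries, plainCount_zero]
    | succ n =>
      rw [map_add, map_add, coeff_succ_X_mul, coeff_succ_X_mul, coeff_succ_X_mul, coeff_mul]
      simp [plainSeries, plainCount_succ]
  have h2 : (PowerSeries.mk 1 : PowerSeries ℂ) * (1 - X) = 1 := mk_one_mul_one_sub_eq_one ℂ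
  linear_combination 4 * X * (X - 1) * h1 - 4 * X ^ 2 * h2

-- Both sides have the same square in the domain of formal power series, so they agree up to sign;
-- the constant coefficient 1 settles the sign.
open PowerSeries in
theorem one_sub_two_X_mul_plainSeries {ρ : ℝ} (h0 : 0 < ρ) (h1 : ρ < 0.3) (hroot : 1 - 3 * ρ - ρ ^ 2 - ρ ^ 3 = 0)
    {P : PowerSeries ℂ} (hP : P.SumsTo ρ (discriminantRoot ρ)) :
    1 - X - 2 * X * plainSeries = P := by
  have hX : ((1 - Polynomial.X : Polynomial ℂ) : PowerSeries ℂ) = 1 - X := by simp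
  have hD : ((1 - 3 * Polynomial.X - Polynomial.X ^ 2 - Polynomial.X ^ 3 : Polynomial ℂ) :
      PowerSeries ℂ) = 1 - 3 * X - X ^ 2 - X ^ 3 := by
    have : ((3 : Polynomial ℂ) : PowerSeries ℂ) = 3 := map_ofNat Polynomial.coeToPowerSeries.ringHom 3
    simp [this]
  have hsq : (1 - X) * (P * P) = 1 - 3 * X - X ^ 2 - X ^ 3 := by
    rw [← hX, ← hD]
    refine (((sumsTo_polynomial _ ρ).mul (hP.mul hP)).congr fun z hz => ?_).unique h0
      (sumsTo_polynomial _ ρ)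
    have := discriminantRoot_sq h0.ne' hroot (z := z) (by linarith)
    simpa [sq] using this
  have hne : (1 - X : PowerSeries ℂ) ≠ 0 := by
    intro h
    simpa using congrArg (constantCoeff (R := ℂ)) h
  have heq : (1 - X - 2 * X * plainSeries) ^ 2 = P ^ 2 :=
    mul_left_cancel₀ hne (by rw [one_sub_X_mul_plainSeries, ← hsq, sq P])
  refine (sq_eq_sq_iff_eq_or_eq_neg.1 heq).resolve_right fun h => ?_
  have h2 := congrArg (coeff (R := ℂ) 0) h
  rw [map_neg, hP.coeff_zero h0, discriminantRoot_zero] at h2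
  norm_num at h2

/-- The number of terms of size `n` is asymptotic to a constant times `ρ⁻ⁿ n^(-3/2)`. -/
theorem tendsto_rpow_mul_plainCount {ρ : ℝ} (h0 : 0 < ρ) (h1 : ρ < 0.3) (hroot : 1 - 3 * ρ - ρ ^ 2 - ρ ^ 3 = 0) :
    Tendsto (fun n : ℕ => (n : ℝ) ^ (3 / 2 : ℝ) * (plainCount n * ρ ^ n)) atTop
      (𝓝 (√((1 + ρ ^ 2 + 2 * ρ ^ 3) / (1 - ρ)) / (4 * √Real.pi * ρ))) := by
  obtain ⟨A, hA⟩ := exists_regularFactor_sumsTo h0 h1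
  have hρ : ‖(ρ : ℂ)‖ = ρ := by rw [Complex.norm_real, Real.norm_of_nonneg h0.le]
  have hρ' : (ρ : ℂ) ≠ 0 := Complex.ofReal_ne_zero.2 h0.ne'
  have hlt : ‖(ρ : ℂ)‖ < 0.5 := by rw [hρ]; linarith
  have hP := one_sub_two_X_mul_plainSeries h0 h1 hroot (discriminantRoot_sumsTo h0 h1 hA)
  have hconv := tendsto_rpow_smul_convolution (by norm_num) tendsto_rpow_smul_coeff_sqrtSeries
    (hA.summable_mul_rpow hlt (3 / 2))
  rw [(hA _ hlt).2] at hconv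
  have hcoeff (n : ℕ) : ∑ p ∈ Finset.HasAntidiagonal.antidiagonal n,
      PowerSeries.coeff p.1 A * (ρ : ℂ) ^ p.1 * PowerSeries.coeff p.2 sqrtSeries =
      PowerSeries.coeff n (1 - PowerSeries.X - 2 * PowerSeries.X * plainSeries) * (ρ : ℂ) ^ n := by
    rw [hP, PowerSeries.coeff_mul, Finset.sum_mul]
    refine Finset.sum_congr rfl fun p hp => ?_
    rw [← Finset.HasAntidiagonal.mem_antidiagonal.1 hp, PowerSeries.coeff_rescale, pow_add,
      inv_pow]
    field_simp
  simp only [hcoeff] at hconv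
  have hshift := (tendsto_add_atTop_iff_nat 1).2 hconv
  have hL : Tendsto (fun n : ℕ => ((n + 1 : ℕ) : ℝ) ^ (3 / 2 : ℝ) •
      (plainCount n * (ρ : ℂ) ^ n)) atTop
      (𝓝 ((-2 * (ρ : ℂ))⁻¹ * (regularFactor ρ ρ * (-2 * ((√Real.pi : ℝ) : ℂ))⁻¹))) := by
    refine (hshift.const_mul _).congr' ?_
    -- From here on `1 - X` contributes nothing to the coefficient of index n + 1.
    filter_upwards [eventually_ge_atTop 1] with n hn
    have hc : PowerSeries.coeff (n + 1) (1 - PowerSeries.X - 2 * PowerSeries.X * plainSeries) =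
        -2 * (plainCount n : ℂ) := by
      have : (2 * PowerSeries.X * plainSeries : PowerSeries ℂ) =
          PowerSeries.X * (PowerSeries.C 2 * plainSeries) := by
        rw [map_ofNat]; ring
      rw [this, map_sub, map_sub, PowerSeries.coeff_succ_X_mul, PowerSeries.coeff_C_mul,
        PowerSeries.coeff_X, PowerSeries.coeff_one, plainSeries, PowerSeries.coeff_mk]
      simp [show n ≠ 0 by omega]
    rw [hc, pow_succ, mul_smul_comm]
    congr 1
    field_simp
  -- The counts are nonnegative, so taking norms loses nothing, and only the modulus of the regular
  -- factor is needed, which its square determines.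
  have hnorm := ((tendsto_rpow_smul_shift_iff 1).1 hL).norm
  have hval : ‖(-2 * (ρ : ℂ))⁻¹ * (regularFactor ρ ρ * (-2 * ((√Real.pi : ℝ) : ℂ))⁻¹)‖ =
      √((1 + ρ ^ 2 + 2 * ρ ^ 3) / (1 - ρ)) / (4 * √Real.pi * ρ) := by
    have hreg : ‖regularFactor ρ ρ‖ = √((1 + ρ ^ 2 + 2 * ρ ^ 3) / (1 - ρ)) := by
      have : 0 < 1 - ρ := by linarith
      rw [eq_comm, Real.sqrt_eq_iff_eq_sq (by positivity) (norm_nonneg _), ← norm_pow,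
        regularFactor_sq]
      have hcast : (1 + ρ * (1 + ρ) * ρ + ρ * ρ ^ 2 : ℂ) / (1 - ρ) =
          (((1 + ρ ^ 2 + 2 * ρ ^ 3) / (1 - ρ) : ℝ) : ℂ) := by push_cast; ring
      rw [hcast, Complex.norm_real, Real.norm_of_nonneg (by positivity)]
    rw [norm_mul, norm_mul, norm_inv, norm_inv, norm_mul, norm_mul, hreg, hρ, Complex.norm_real,
      Real.norm_of_nonneg (Real.sqrt_nonneg _), norm_neg, Complex.norm_ofNat]
    ring
  rw [hval] at hnorm
  refine hnorm.congr fun n => ?_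
  rw [norm_smul, norm_mul, norm_pow, hρ, Complex.norm_natCast, Real.norm_of_nonneg (by positivity)]

/-! ### Radius of convergence and dominating singularity -/

/-- The sum of the generating function of all terms. -/
noncomputable def plainSum (z : ℂ) : ℂ :=
  ∑' n, (plainCount n : ℂ) * z ^ n

theorem le_radius_plainCount {ρ : ℝ} (h0 : 0 < ρ) (h1 : ρ < 0.3) (hroot : 1 - 3 * ρ - ρ ^ 2 - ρ ^ 3 = 0) : ENNReal.ofReal ρ ≤
    (FormalMultilinearSeries.ofScalars ℂ (fun n => (plainCount n : ℂ))).radius := by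
  obtain ⟨M, hM⟩ := (((tendsto_rpow_smul_shift_iff 1).2
    (tendsto_rpow_mul_plainCount h0 h1 hroot))).bddAbove_range
  refine FormalMultilinearSeries.le_radius_of_bound _ M fun n => ?_
  rw [FormalMultilinearSeries.ofScalars_norm, Complex.norm_natCast, Real.coe_toNNReal _ h0.le]
  refine le_trans ?_ (hM ⟨n, rfl⟩)
  exact le_mul_of_one_le_left (by positivity)
    (Real.one_le_rpow (by simp) (by norm_num))

theorem hasFPowerSeriesOnBall_plainSum {r : ENNReal} (hr : 0 < r)
    (h : r ≤ (FormalMultilinearSeries.ofScalars ℂ (fun n => (plainCount n : ℂ))).radius) :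
    HasFPowerSeriesOnBall plainSum (.ofScalars ℂ fun n => (plainCount n : ℂ)) 0 r := by
  convert (FormalMultilinearSeries.hasFPowerSeriesOnBall _ (hr.trans_le h)).mono hr h using 1
  ext z
  rw [plainSum, FormalMultilinearSeries.sum]
  simp [mul_comm]

theorem plainSeries_sumsTo {ρ : ℝ} (h0 : 0 < ρ) (h1 : ρ < 0.3) (hroot : 1 - 3 * ρ - ρ ^ 2 - ρ ^ 3 = 0) :
    plainSeries.SumsTo ρ plainSum := by
  have h := PowerSeries.sumsTo_of_hasFPowerSeriesOnBall (hasFPowerSeriesOnBall_plainSum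
    (ENNReal.ofReal_pos.2 h0) (le_radius_plainCount h0 h1 hroot))
  convert h using 1
  ext n
  simp [plainSeries]

theorem one_sub_two_mul_plainSum {ρ : ℝ} (h0 : 0 < ρ) (h1 : ρ < 0.3) (hroot : 1 - 3 * ρ - ρ ^ 2 - ρ ^ 3 = 0) {z : ℂ} (hz : ‖z‖ < ρ) :
    1 - z - 2 * z * plainSum z = discriminantRoot ρ z := by
  obtain ⟨A, hA⟩ := exists_regularFactor_sumsTo h0 h1
  have hP := discriminantRoot_sumsTo h0 h1 hA
  have h2 := one_sub_two_X_mul_plainSeries h0 h1 hroot hP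
  have hX : ((1 - Polynomial.X : Polynomial ℂ) : PowerSeries ℂ) = 1 - PowerSeries.X := by simp
  have h2X : ((Polynomial.C 2 * Polynomial.X : Polynomial ℂ) : PowerSeries ℂ) =
      2 * PowerSeries.X := by
    rw [Polynomial.coe_mul, Polynomial.coe_C, Polynomial.coe_X, map_ofNat]
  rw [← h2, ← hX, ← h2X] at hP
  have h3 := ((PowerSeries.sumsTo_polynomial (1 - Polynomial.X) ρ).sub
    ((PowerSeries.sumsTo_polynomial (Polynomial.C 2 * Polynomial.X) ρ).mul
      (plainSeries_sumsTo h0 h1 hroot)) z hz).2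
  rw [(hP z hz).2] at h3
  simpa using h3.symm

/-- An extension would make (1-z)u² = 1-3z-z²-z³ hold near ρ with u analytic. Then u vanishes at ρ,
so the left side has derivative zero there, while ρ is a simple root of the right side. -/
theorem not_exists_analyticAt_eq_plainSum {ρ : ℝ} (h0 : 0 < ρ) (h1 : ρ < 0.3) (hroot : 1 - 3 * ρ - ρ ^ 2 - ρ ^ 3 = 0) :
    ¬ ∃ g : ℂ → ℂ, AnalyticAt ℂ g ρ ∧ ∀ᶠ z in 𝓝 (ρ : ℂ), ‖z‖ < ‖(ρ : ℂ)‖ → g z = plainSum z := by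
  rintro ⟨g, hg, hgeq⟩
  have hρ : ‖(ρ : ℂ)‖ = ρ := by rw [Complex.norm_real, Real.norm_of_nonneg h0.le]
  let u : ℂ → ℂ := fun z => 1 - z - 2 * z * g z
  have hu : AnalyticAt ℂ u ρ := by
    unfold u
    fun_prop
  have hfreq : ∃ᶠ z in 𝓝[≠] (ρ : ℂ), (1 - z) * u z ^ 2 = 1 - 3 * z - z ^ 2 - z ^ 3 := by
    -- Real points approaching ρ from the left lie in the disc and accumulate at ρ, which is enough
    -- for the identity theorem.
    have htend : Tendsto (fun t : ℝ => (t : ℂ)) (𝓝[<] ρ) (𝓝[≠] (ρ : ℂ)) := by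
      refine tendsto_nhdsWithin_iff.2 ⟨(Complex.continuous_ofReal.tendsto ρ).mono_left
        nhdsWithin_le_nhds, ?_⟩
      filter_upwards [self_mem_nhdsWithin] with t ht
      simpa using (ne_of_lt ht : t ≠ ρ)
    refine htend.frequently (Eventually.frequently ?_)
    filter_upwards [htend.eventually (nhdsWithin_le_nhds hgeq), Ioo_mem_nhdsLT h0] with t ht htI
    have htn : ‖(t : ℂ)‖ < ρ := by
      rw [Complex.norm_real, Real.norm_of_nonneg htI.1.le]
      exact htI.2
    simp only [u]
    rw [ht (by rwa [hρ]), one_sub_two_mul_plainSum h0 h1 hroot htn,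
      discriminantRoot_sq h0.ne' hroot (by linarith)]
  have hev := (AnalyticAt.frequently_eq_iff_eventually_eq (by fun_prop) (by fun_prop)).1 hfreq
  have hρ1 : (1 - ρ : ℂ) ≠ 0 := by
    rw [← Complex.ofReal_one, ← Complex.ofReal_sub, Complex.ofReal_ne_zero]
    linarith
  have hrootC : (1 - 3 * ρ - ρ ^ 2 - ρ ^ 3 : ℂ) = 0 := by exact_mod_cast hroot
  have hu0 : u ρ = 0 := by
    have := hev.self_of_nhds
    rw [hrootC] at this
    simpa [hρ1] using this
  have hd1 : HasDerivAt (fun z : ℂ => (1 - z) * u z ^ 2) 0 ρ := by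
    convert! ((hasDerivAt_id (ρ : ℂ)).const_sub 1).mul (hu.differentiableAt.hasDerivAt.pow 2) using 1
    simp [hu0]
  have hd2 : HasDerivAt (fun z : ℂ => 1 - 3 * z - z ^ 2 - z ^ 3)
      (-3 - 2 * (ρ : ℂ) - 3 * (ρ : ℂ) ^ 2) ρ := by
    convert! ((((hasDerivAt_id (ρ : ℂ)).const_mul 3).const_sub 1).sub
      (hasDerivAt_pow 2 (ρ : ℂ))).sub (hasDerivAt_pow 3 (ρ : ℂ)) using 1
    simp
  have heq := (hd1.congr_of_eventuallyEq (hev.mono fun _ hz => hz.symm)).unique hd2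
  have heqR : (0 : ℝ) = -3 - 2 * ρ - 3 * ρ ^ 2 := by exact_mod_cast heq
  nlinarith

/-- A larger radius would make the sum itself analytic at ρ. -/
theorem radius_plainCount {ρ : ℝ} (h0 : 0 < ρ) (h1 : ρ < 0.3) (hroot : 1 - 3 * ρ - ρ ^ 2 - ρ ^ 3 = 0) :
    (FormalMultilinearSeries.ofScalars ℂ (fun n => (plainCount n : ℂ))).radius =
      ENNReal.ofReal ρ := by
  refine le_antisymm (not_lt.1 fun hlt => ?_) (le_radius_plainCount h0 h1 hroot)
  refine not_exists_analyticAt_eq_plainSum h0 h1 hroot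
    ⟨plainSum, ?_, Eventually.of_forall fun _ _ => rfl⟩
  refine (hasFPowerSeriesOnBall_plainSum (zero_le.trans_lt hlt) le_rfl).analyticAt_of_mem ?_
  rw [Metric.mem_eball, edist_zero_right, ← ofReal_norm, Complex.norm_real,
    Real.norm_of_nonneg h0.le]
  exact hlt

theorem isDominatingSingularity_plainCount_iff {ρ : ℝ} (h0 : 0 < ρ) (h1 : ρ < 0.3) (hroot : 1 - 3 * ρ - ρ ^ 2 - ρ ^ 3 = 0) (ζ : ℂ) :
    IsDominatingSingularity plainCount ζ ↔ ζ = ρ := by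
  rw [IsDominatingSingularity, radius_plainCount h0 h1 hroot, ← ofReal_norm,
    ENNReal.ofReal_eq_ofReal_iff (norm_nonneg _) h0.le]
  constructor
  · rintro ⟨hζ, hsing⟩
    by_contra hne
    have hρ' : (ρ : ℂ) ≠ 0 := Complex.ofReal_ne_zero.2 h0.ne'
    have hζ0 : ζ ≠ 0 := norm_pos_iff.1 (hζ ▸ h0)
    have hslit : 1 - (ρ : ℂ)⁻¹ * ζ ∈ Complex.slitPlane := by
      have hw : ‖(ρ : ℂ)⁻¹ * ζ‖ = 1 := by
        rw [norm_mul, norm_inv, hζ, Complex.norm_real, Real.norm_of_nonneg h0.le,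
          inv_mul_cancel₀ h0.ne']
      have hw1 : (ρ : ℂ)⁻¹ * ζ ≠ 1 := fun h => hne (by
        rw [inv_mul_eq_iff_eq_mul₀ hρ', mul_one] at h
        exact h)
      -- A number of modulus 1 with real part 1 is 1, so away from ρ the base of the square root has
      -- positive real part.
      have hre : ((ρ : ℂ)⁻¹ * ζ).re < 1 := by
        refine lt_of_le_of_ne (hw ▸ Complex.re_le_norm _) fun h => hw1 ?_
        rw [← hw, Complex.re_eq_norm] at h
        have h2 := Complex.eq_coe_norm_of_nonneg h
        rw [hw] at h2
        simpa using h2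
      refine Or.inl ?_
      rw [Complex.sub_re, Complex.one_re]
      linarith
    have hroot' : AnalyticAt ℂ (discriminantRoot ρ) ζ :=
      (analyticAt_regularFactor h0 h1 (by linarith)).mul
        (AnalyticAt.cpow (by fun_prop) analyticAt_const hslit)
    -- The quadratic formula for L, with the branch that is valid inside the disc.
    refine hsing ⟨fun z => (1 - z - discriminantRoot ρ z) / (2 * z),
      AnalyticAt.div (by fun_prop) (by fun_prop) (by simpa using hζ0), ?_⟩
    filter_upwards [isOpen_ne.mem_nhds hζ0] with z hz hzn
    rw [hζ] at hzn
    rw [← one_sub_two_mul_plainSum h0 h1 hroot hzn, plainSum]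
    have : z ≠ 0 := hz
    field_simp
    ring
  · rintro rfl
    exact ⟨by rw [Complex.norm_real, Real.norm_of_nonneg h0.le],
      not_exists_analyticAt_eq_plainSum h0 h1 hroot⟩

/-! ### Numerical bounds and conclusion -/

theorem exists_root_mem_Icc : ∃ ρ : ℝ, ρ ∈ Set.Icc (0.295597 : ℝ) 0.295598 ∧
    1 - 3 * ρ - ρ ^ 2 - ρ ^ 3 = 0 := by
  have hc : ContinuousOn (fun x : ℝ => 1 - 3 * x - x ^ 2 - x ^ 3)
      (Set.Icc 0.295597 0.295598) := by fun_prop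
  exact intermediate_value_Icc' (by norm_num) hc ⟨by norm_num, by norm_num⟩

/-- Squaring removes both roots; numerator and denominator are then bounded separately at the ends
of the interval, with six-digit bounds on π. -/
theorem abs_constant_sub_lt {ρ : ℝ} (hρ : ρ ∈ Set.Icc (0.295597 : ℝ) 0.295598) :
    |√((1 + ρ ^ 2 + 2 * ρ ^ 3) / (1 - ρ)) / (4 * √Real.pi * ρ) - 0.60676| < 1 / 10 ^ 5 := by
  obtain ⟨hl, hu⟩ := hρ
  have h0 : 0 < ρ := by linarith
  have h1 : 0 < 1 - ρ := by linarith
  have hpi := Real.pi_pos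
  have hsq : (√((1 + ρ ^ 2 + 2 * ρ ^ 3) / (1 - ρ)) / (4 * √Real.pi * ρ)) ^ 2 =
      (1 + ρ ^ 2 + 2 * ρ ^ 3) / ((1 - ρ) * (16 * Real.pi * ρ ^ 2)) := by
    rw [div_pow, mul_pow, mul_pow, Real.sq_sqrt (by positivity), Real.sq_sqrt hpi.le]
    field_simp
    norm_num
  have hlow : (0.60675 : ℝ) ^ 2 < (1 + ρ ^ 2 + 2 * ρ ^ 3) / ((1 - ρ) * (16 * Real.pi * ρ ^ 2)) :=
    calc (0.60675 : ℝ) ^ 2 < (1 + 0.295597 ^ 2 + 2 * 0.295597 ^ 3) /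
          ((1 - 0.295597) * (16 * 3.141593 * 0.295598 ^ 2)) := by norm_num
      _ ≤ _ := by
        gcongr
        exact Real.pi_lt_d6.le
  have hupp : (1 + ρ ^ 2 + 2 * ρ ^ 3) / ((1 - ρ) * (16 * Real.pi * ρ ^ 2)) < (0.60677 : ℝ) ^ 2 :=
    calc
      (1 + ρ ^ 2 + 2 * ρ ^ 3) / ((1 - ρ) * (16 * Real.pi * ρ ^ 2)) ≤
          (1 + 0.295598 ^ 2 + 2 * 0.295598 ^ 3) /
            ((1 - 0.295598) * (16 * 3.141592 * 0.295597 ^ 2)) := by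
        gcongr
        exact Real.pi_gt_d6.le
      _ < (0.60677 : ℝ) ^ 2 := by norm_num
  rw [← hsq] at hlow hupp
  have h2 := lt_of_pow_lt_pow_left₀ 2 (by positivity) hlow
  have h3 := lt_of_pow_lt_pow_left₀ 2 (by positivity) hupp
  rw [abs_lt]
  constructor <;> linarith

theorem isEquivalent_neutralHNFCount {ρ C : ℝ} (h0 : 0 < ρ) (hC : C ≠ 0)
    (h : Tendsto (fun n : ℕ => (n : ℝ) ^ (3 / 2 : ℝ) * (plainCount n * ρ ^ n)) atTop (𝓝 C)) :
    (fun n : ℕ => (neutralHNFCount (n + 1) : ℝ)) ~[atTop]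
      fun n : ℕ => (1 / ρ) ^ n * (C / (n : ℝ) ^ (3 / 2 : ℝ)) := by
  refine isEquivalent_of_tendsto_one ?_
  have h2 := h.div_const C
  rw [div_self hC] at h2
  refine h2.congr' ?_
  filter_upwards [eventually_gt_atTop 0] with n hn
  have : (0 : ℝ) < (n : ℝ) ^ (3 / 2 : ℝ) := Real.rpow_pos_of_pos (Nat.cast_pos.2 hn) _
  rw [Pi.div_apply, neutralHNFCount_succ hn.ne', one_div, inv_pow]
  field_simp

/-- The ratio at n + 1 is that of consecutive term counts, which tends to ρ since the polynomial
factor is insensitive to the shift. -/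
theorem tendsto_neutralHNFCount_div_plainCount {ρ C : ℝ} (h0 : 0 < ρ) (hC : C ≠ 0)
    (h : Tendsto (fun n : ℕ => (n : ℝ) ^ (3 / 2 : ℝ) * (plainCount n * ρ ^ n)) atTop (𝓝 C)) :
    Tendsto (fun n : ℕ => (neutralHNFCount n : ℝ) / (plainCount n : ℝ)) atTop (𝓝 ρ) := by
  rw [← tendsto_add_atTop_iff_nat 1]
  have h1 := (tendsto_rpow_smul_shift_iff 1).2 h
  have h2 := (h1.div ((tendsto_add_atTop_iff_nat 1).2 h) hC).const_mul ρ
  rw [div_self hC, mul_one] at h2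
  refine h2.congr' ?_
  filter_upwards [eventually_gt_atTop 0] with n hn
  have : (0 : ℝ) < ((n + 1 : ℕ) : ℝ) ^ (3 / 2 : ℝ) := by positivity
  rw [neutralHNFCount_succ hn.ne', Pi.div_apply, smul_eq_mul, mul_div_mul_left _ _ this.ne', pow_succ]
  field_simp

theorem mainTheorem9 :
    -- there are finitely many terms of each size
    (∀ n : ℕ, {t : LTerm | t.size = n}.Finite) ∧
    -- `K(z) = z + z L(z)`
    genFun neutralHNFCount = PowerSeries.X + PowerSeries.X * genFun plainCount ∧
    -- the correspondence is a bijection from the neutral head normal forms other than `0` onto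
    -- all plain terms, and it lowers the size by one
    (∃ e : {k : LTerm // k.IsNeutralHNF ∧ k ≠ LTerm.idx .zero} ≃ LTerm,
      (∀ k t : LTerm, LTerm.Corresponds k t ↔ ∃ hk, e ⟨k, hk⟩ = t) ∧
      ∀ k, k.1.size = (e k).size + 1) ∧
    -- asymptotics and density
    (∃ ρ C : ℝ,
      (∀ ζ : ℂ, IsDominatingSingularity plainCount ζ ↔ ζ = (ρ : ℂ)) ∧
      1 - 3 * ρ - ρ ^ 2 - ρ ^ 3 = 0 ∧
      |ρ - 0.29559| < 1 / 10 ^ 5 ∧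
      |C - 0.60676| < 1 / 10 ^ 5 ∧
      ((fun n : ℕ => (neutralHNFCount (n + 1) : ℝ)) ~[atTop]
        fun n : ℕ => (1 / ρ) ^ n * (C / (n : ℝ) ^ (3 / 2 : ℝ))) ∧
      Tendsto (fun n : ℕ => (neutralHNFCount n : ℝ) / (plainCount n : ℝ)) atTop (𝓝 ρ)) := by

  refine ⟨fun n => LTerm.finite_size_eq n, genFun_neutralHNFCount,
    ⟨LTerm.neutralEquiv.symm, fun k t => ?_, fun k => ?_⟩, ?_⟩
  · rw [LTerm.corresponds_iff]
    constructor
    · rintro rfl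
      exact ⟨⟨t.isNeutralHNF_toNeutral, t.toNeutral_ne_zero⟩, LTerm.neutralEquiv.symm_apply_apply t⟩
    · rintro ⟨hk, rfl⟩
      exact congrArg Subtype.val (LTerm.neutralEquiv.apply_symm_apply ⟨k, hk⟩)
  · obtain ⟨t, rfl⟩ := LTerm.neutralEquiv.surjective k
    rw [Equiv.symm_apply_apply, LTerm.coe_neutralEquiv, LTerm.size_toNeutral]
  · obtain ⟨ρ, hρ, hroot⟩ := exists_root_mem_Icc
    have h0 : 0 < ρ := by linarith [hρ.1]
    have h1 : ρ < 0.3 := by linarith [hρ.2]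
    have hlim := tendsto_rpow_mul_plainCount h0 h1 hroot
    have hCb := abs_constant_sub_lt hρ
    have hC : √((1 + ρ ^ 2 + 2 * ρ ^ 3) / (1 - ρ)) / (4 * √Real.pi * ρ) ≠ 0 := by
      intro h
      rw [h] at hCb
      norm_num [abs_lt] at hCb
    refine ⟨ρ, _, isDominatingSingularity_plainCount_iff h0 h1 hroot, hroot, ?_, hCb,
      isEquivalent_neutralHNFCount h0 hC hlim, tendsto_neutralHNFCount_div_plainCount h0 hC hlim⟩
    rw [abs_lt]
    constructor <;> linarith [hρ.1, hρ.2]
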